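/- Let $R$ be a Banach ring, i.e. a commutative ring with $1$ with a complete norm satisfying $|ab|\le C|a||b|$ for some constant $C>0$. Let $\mathrm{Ban}_R$ be the category of Banach $R$-modules (complete normed $R$-modules $M$ with $\|am\|\le C_M|a|\|m\|$ for some constant $C_M>0$) and bounded $R$-linear maps. It carries the completed projective tensor product $M\widehat\otimes_R N$, the separated completion of $M\otimes_R N$ for the seminorm $\|x\|=\inf\{\sum_i\|m_i\|\|n_i\| : x=\sum_i m_i\otimes n_i\}$, the internal Hom $\underline{\mathrm{Hom}}(M,N)$ of bounded $R$-linear maps with the operator norm, and the dual $M^\vee=\underline{\mathrm{Hom}}(M,R)$. Extend these to the category $\mathrm{Ind}(\mathrm{Ban}_R)$ of ind-objects by $``\mathrm{colim}_i"V_i\,\widehat\otimes_R\,``\mathrm{colim}_j"W_j=``\mathrm{colim}_{(i,j)}"\,V_i\widehat\otimes_R W_j$ and, for $W\in\mathrm{Ban}_R$, $\underline{\mathrm{Hom}}(W,``\mathrm{colim}_i"V_i)=``\mathrm{colim}_i"\,\underline{\mathrm{Hom}}(W,V_i)$. An object $V$ of $\mathrm{Ind}(\mathrm{Ban}_R)$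 is called nuclear if for every Banach $R$-module $W$ the natural morphism $W^\vee\widehat\otimes_R V\to\underline{\mathrm{Hom}}(W,V)$, induced by $\alpha\otimes v\mapsto(w\mapsto\alpha(w)v)$, is an isomorphism. A morphism $f$ is called strict if the canonical morphism $\mathrm{coim}(f)\to\mathrm{im}(f)$ is an isomorphism, where $\mathrm{im}(f)=\ker(\mathrm{coker} f)$ and $\mathrm{coim}(f)=\mathrm{coker}(\ker f)$. An object $F$ is called flat if the functor $(-)\widehat\otimes_R F$ preserves strict monomorphisms. Lemma. Every nuclear object of $\mathrm{Ind}(\mathrm{Ban}_R)$ is flat in $\mathrm{Ind}(\mathrm{Ban}_R)$. -/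

import Mathlib

open CategoryTheory CategoryTheory.Limits
open scoped TensorProduct

noncomputable section

/-- A Banach ring: a commutative unital ring with a complete norm for which multiplication is
bounded, `|a b| ≤ C |a| |b|` for some constant `C > 0`. Neither `C = 1` nor `|1| = 1` is required. -/
class BanachRing.{u} (R : Type u) extends NormedAddCommGroup R, CommRing R where
  complete : CompleteSpace R
  exists_norm_mul_le : ∃ C : ℝ, 0 < C ∧ ∀ a b : R, ‖a * b‖ ≤ C * ‖a‖ * ‖b‖

/-- A Banach module over a Banach ring `R`. -/
structure BanMod.{u} (R : Type u) [BanachRing R] : Type (u + 1) where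
  carrier : Type u
  [normed : NormedAddCommGroup carrier]
  [module : Module R carrier]
  [complete : CompleteSpace carrier]
  exists_norm_smul_le : ∃ C : ℝ, 0 < C ∧ ∀ (a : R) (m : carrier), ‖a • m‖ ≤ C * ‖a‖ * ‖m‖

namespace BanMod

universe u

variable {R : Type u} [BanachRing R]

instance : CoeSort (BanMod R) (Type u) := ⟨BanMod.carrier⟩

attribute [instance] BanMod.normed BanMod.module BanMod.complete

/-- The ring `R` as a Banach module over itself. -/
abbrev unit (R : Type u) [BanachRing R] : BanMod R :=
  haveI : CompleteSpace R := BanachRing.complete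
  { carrier := R
    exists_norm_smul_le := BanachRing.exists_norm_mul_le }

instance continuousConstSMul (M : BanMod R) : ContinuousConstSMul R M where
  continuous_const_smul a := by
    obtain ⟨C, -, h⟩ := M.exists_norm_smul_le
    exact AddMonoidHomClass.continuous_of_bound (DistribSMul.toAddMonoidHom M a) (C * ‖a‖) (h a)

/-! ### Bounded linear maps and the internal Hom -/

/-- The `R`-module of bounded `R`-linear maps. -/
def bounded (M N : BanMod R) : Submodule R (M →ₗ[R] N) where
  carrier := {f | ∃ C : ℝ, ∀ m, ‖f m‖ ≤ C * ‖m‖}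
  zero_mem' := ⟨0, by simp⟩
  add_mem' := by
    rintro f g ⟨C, hC⟩ ⟨D, hD⟩
    refine ⟨C + D, fun m => ?_⟩
    rw [add_mul]
    exact (norm_add_le _ _).trans (add_le_add (hC m) (hD m))
  smul_mem' := by
    rintro a f ⟨C, hC⟩
    obtain ⟨D, hD, h⟩ := N.exists_norm_smul_le
    refine ⟨D * ‖a‖ * C, fun m => (h a (f m)).trans ?_⟩
    rw [mul_assoc (D * ‖a‖)]
    exact mul_le_mul_of_nonneg_left (hC m) (by positivity)

/-- The type of bounded `R`-linear maps `M → N`. -/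
def HomSpace (M N : BanMod R) : Type u := bounded M N

namespace HomSpace

variable {M N P : BanMod R}

instance : AddCommGroup (HomSpace M N) := inferInstanceAs (AddCommGroup (bounded M N))

instance : Module R (HomSpace M N) := inferInstanceAs (Module R (bounded M N))

instance : FunLike (HomSpace M N) M N where
  coe f := f.1
  coe_injective _ _ h := Subtype.ext (DFunLike.coe_injective h)

instance : AddMonoidHomClass (HomSpace M N) M N where
  map_add f := f.1.map_add
  map_zero f := f.1.map_zero

/-- A bounded linear map from a linear map and a bound. -/
def mk (f : M →ₗ[R] N) (h : ∃ C : ℝ, ∀ m, ‖f m‖ ≤ C * ‖m‖) : HomSpace M N := ⟨f, h⟩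

@[simp] theorem mk_apply (f : M →ₗ[R] N) (h : ∃ C : ℝ, ∀ m, ‖f m‖ ≤ C * ‖m‖) (m : M) :
    mk f h m = f m := rfl

@[ext] theorem ext {f g : HomSpace M N} (h : ∀ m, f m = g m) : f = g := DFunLike.ext _ _ h

@[simp] theorem add_apply (f g : HomSpace M N) (m : M) : (f + g) m = f m + g m := rfl

@[simp] theorem neg_apply (f : HomSpace M N) (m : M) : (-f) m = -f m := rfl

@[simp] theorem sub_apply (f g : HomSpace M N) (m : M) : (f - g) m = f m - g m := rfl

@[simp] theorem zero_apply (m : M) : (0 : HomSpace M N) m = 0 := rfl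

@[simp] theorem smul_apply (a : R) (f : HomSpace M N) (m : M) : (a • f) m = a • f m := rfl

theorem map_smul (f : HomSpace M N) (a : R) (m : M) : f (a • m) = a • f m := f.1.map_smul a m

theorem exists_bound (f : HomSpace M N) : ∃ C : ℝ, 0 ≤ C ∧ ∀ m, ‖f m‖ ≤ C * ‖m‖ := by
  obtain ⟨C, hC⟩ := f.2
  exact ⟨max C 0, le_max_right _ _, fun m => (hC m).trans
    (mul_le_mul_of_nonneg_right (le_max_left _ _) (norm_nonneg _))⟩

theorem continuous (f : HomSpace M N) : Continuous f := by
  obtain ⟨C, hC⟩ := f.2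
  exact AddMonoidHomClass.continuous_of_bound f C hC

/-- The operator norm `sup ‖f m‖ / ‖m‖` (the term `m = 0` contributes `0 / 0 = 0`). -/
instance : Norm (HomSpace M N) := ⟨fun f => ⨆ m : M, ‖f m‖ / ‖m‖⟩

theorem norm_def (f : HomSpace M N) : ‖f‖ = ⨆ m : M, ‖f m‖ / ‖m‖ := rfl

theorem norm_le {f : HomSpace M N} {c : ℝ} (hc : 0 ≤ c) (h : ∀ m, ‖f m‖ ≤ c * ‖m‖) : ‖f‖ ≤ c :=
  ciSup_le fun m => div_le_of_le_mul₀ (norm_nonneg _) hc (h m)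

theorem nonneg (f : HomSpace M N) : 0 ≤ ‖f‖ := Real.iSup_nonneg fun _ => by positivity

theorem le_norm (f : HomSpace M N) (m : M) : ‖f m‖ ≤ ‖f‖ * ‖m‖ := by
  obtain ⟨C, hC, h⟩ := f.exists_bound
  rcases eq_or_ne m 0 with rfl | hm
  · simp
  · have hb : BddAbove (Set.range fun m : M => ‖f m‖ / ‖m‖) := by
      refine ⟨C, ?_⟩
      rintro _ ⟨x, rfl⟩
      exact div_le_of_le_mul₀ (norm_nonneg _) hC (h x)
    exact (div_le_iff₀ (norm_pos_iff.2 hm)).1 (le_ciSup hb m)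

instance : NormedAddCommGroup (HomSpace M N) :=
  AddGroupNorm.toNormedAddCommGroup
    { toFun := fun f => ‖f‖
      map_zero' := le_antisymm (norm_le le_rfl (by simp)) (nonneg _)
      add_le' := fun f g => norm_le (add_nonneg (nonneg f) (nonneg g)) fun m => by
        rw [add_mul]
        exact (norm_add_le _ _).trans (add_le_add (le_norm f m) (le_norm g m))
      neg' := fun f => by simp [norm_def]
      eq_zero_of_map_eq_zero' := fun f hf => by
        ext m
        have h := le_norm f m
        have hf' : ‖f‖ = 0 := hf
        rw [hf', zero_mul] at h
        simpa using h }

instance : CompleteSpace (HomSpace M N) := by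
  refine Metric.complete_of_cauchySeq_tendsto fun u hu => ?_
  rw [Metric.cauchySeq_iff] at hu
  simp only [dist_eq_norm] at hu
  have hsub : ∀ (f g : HomSpace M N) (m : M), ‖f m - g m‖ ≤ ‖f - g‖ * ‖m‖ :=
    fun f g m => le_norm (f - g) m
  have hpt : ∀ m : M, ∃ y : N, Filter.Tendsto (fun n => u n m) Filter.atTop (nhds y) := by
    intro m
    refine cauchySeq_tendsto_of_complete (Metric.cauchySeq_iff.2 fun ε hε => ?_)
    obtain ⟨K, hK⟩ := hu (ε / (‖m‖ + 1)) (by positivity)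
    refine ⟨K, fun n hn k hk => ?_⟩
    rw [dist_eq_norm]
    refine (hsub _ _ m).trans_lt ?_
    calc ‖u n - u k‖ * ‖m‖ ≤ ε / (‖m‖ + 1) * ‖m‖ :=
          mul_le_mul_of_nonneg_right (hK n hn k hk).le (norm_nonneg _)
      _ < ε := by
          rw [div_mul_eq_mul_div, div_lt_iff₀ (by positivity)]
          nlinarith
  choose g hg using hpt
  have hest : ∀ ε > 0, ∃ K, ∀ n ≥ K, ∀ m, ‖u n m - g m‖ ≤ ε * ‖m‖ := by
    intro ε hε
    obtain ⟨K, hK⟩ := hu ε hε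
    refine ⟨K, fun n hn m => ?_⟩
    refine le_of_tendsto ((tendsto_const_nhds.sub (hg m)).norm) ?_
    filter_upwards [Filter.eventually_ge_atTop K] with k hk
    exact (hsub _ _ m).trans (mul_le_mul_of_nonneg_right (hK n hn k hk).le (norm_nonneg _))
  let G : M →ₗ[R] N :=
    { toFun := g
      map_add' := fun x y => tendsto_nhds_unique (hg (x + y))
        (((hg x).add (hg y)).congr fun n => (map_add (u n) x y).symm)
      map_smul' := fun a x => tendsto_nhds_unique (hg (a • x))
        (((hg x).const_smul a).congr fun n => (map_smul (u n) a x).symm) }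
  have hG : ∃ C : ℝ, ∀ m, ‖G m‖ ≤ C * ‖m‖ := by
    obtain ⟨K, hK⟩ := hest 1 one_pos
    refine ⟨‖u K‖ + 1, fun m => ?_⟩
    have h1 := hK K le_rfl m
    have h2 := le_norm (u K) m
    have h3 : ‖g m‖ ≤ ‖u K m‖ + ‖u K m - g m‖ := by
      simpa using norm_sub_le (u K m) (u K m - g m)
    change ‖g m‖ ≤ _
    linarith
  refine ⟨mk G hG, Metric.tendsto_atTop.2 fun ε hε => ?_⟩
  obtain ⟨K, hK⟩ := hest (ε / 2) (by positivity)
  refine ⟨K, fun n hn => ?_⟩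
  rw [dist_eq_norm]
  exact (norm_le (by positivity) (hK n hn)).trans_lt (by linarith)

/-- The identity. -/
def id (M : BanMod R) : HomSpace M M := mk LinearMap.id ⟨1, fun m => by simp⟩

/-- Composition. -/
def comp (g : HomSpace N P) (f : HomSpace M N) : HomSpace M P :=
  mk (g.1.comp f.1) (by
    obtain ⟨C, _, hC⟩ := f.exists_bound
    obtain ⟨D, hD, hD'⟩ := g.exists_bound
    refine ⟨D * C, fun m => (hD' (f m)).trans ?_⟩
    rw [mul_assoc]
    exact mul_le_mul_of_nonneg_left (hC m) hD)

@[simp] theorem id_apply (m : M) : id M m = m := rfl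

@[simp] theorem comp_apply (g : HomSpace N P) (f : HomSpace M N) (m : M) : comp g f m = g (f m) :=
  rfl

end HomSpace

/-- The category of Banach modules over `R` with bounded `R`-linear maps. -/
instance category : Category (BanMod R) where
  Hom M N := HomSpace M N
  id M := HomSpace.id M
  comp f g := HomSpace.comp g f

instance concreteCategory : ConcreteCategory (BanMod R) (fun M N => HomSpace M N) where
  hom f := f
  ofHom f := f

/-- Boundedness of the scalar multiplication on the space of bounded maps. -/
theorem HomSpace.exists_norm_smul_le (M N : BanMod R) :
    ∃ C : ℝ, 0 < C ∧ ∀ (a : R) (f : HomSpace M N), ‖a • f‖ ≤ C * ‖a‖ * ‖f‖ := by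
  obtain ⟨C, hC, h⟩ := N.exists_norm_smul_le
  refine ⟨C, hC, fun a f => norm_le (by positivity) fun m => (h a (f m)).trans ?_⟩
  rw [mul_assoc (C * ‖a‖)]
  exact mul_le_mul_of_nonneg_left (le_norm f m) (by positivity)

/-- The internal Hom: bounded linear maps with the operator norm. -/
abbrev homObj (M N : BanMod R) : BanMod R where
  carrier := HomSpace M N
  exists_norm_smul_le := HomSpace.exists_norm_smul_le M N

/-- Postcomposition with a bounded map. -/
def homMap (M : BanMod R) {N P : BanMod R} (g : HomSpace N P) :
    HomSpace (homObj M N) (homObj M P) :=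
  HomSpace.mk
    { toFun := fun f : HomSpace M N => HomSpace.comp g f
      map_add' := fun f₁ f₂ : HomSpace M N => HomSpace.ext fun m => map_add g (f₁ m) (f₂ m)
      map_smul' := fun a (f : HomSpace M N) => HomSpace.ext fun m => g.map_smul a (f m) }
    ⟨‖g‖, fun f : HomSpace M N => HomSpace.norm_le (mul_nonneg g.nonneg f.nonneg) fun m => by
      refine (HomSpace.le_norm g (f m)).trans ?_
      rw [mul_assoc]
      exact mul_le_mul_of_nonneg_left (HomSpace.le_norm f m) (norm_nonneg _)⟩

/-- The functor `N ↦ Hom(M, N)`. -/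
abbrev ihom (M : BanMod R) : BanMod R ⥤ BanMod R where
  obj N := homObj M N
  map g := homMap M g

/-- The dual `Hom(M, R)`. -/
abbrev dual (M : BanMod R) : BanMod R := homObj M (unit R)

/-! ### The completed projective tensor product -/

/-- The algebraic tensor product, carrying the projective seminorm. -/
def AlgTensor (M N : BanMod R) : Type u := M ⊗[R] N

namespace AlgTensor

variable {M N : BanMod R}

instance : AddCommGroup (AlgTensor M N) := inferInstanceAs (AddCommGroup (M ⊗[R] N))

instance : Module R (AlgTensor M N) := inferInstanceAs (Module R (M ⊗[R] N))

/-- Pure tensors, as a bilinear map. -/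
def tmul (M N : BanMod R) : M →ₗ[R] N →ₗ[R] AlgTensor M N := TensorProduct.mk R M N

/-- The numbers `∑ ‖mᵢ‖ ‖nᵢ‖` for the finite presentations `x = ∑ mᵢ ⊗ nᵢ`. -/
def costs (x : AlgTensor M N) : Set ℝ :=
  {r | ∃ l : List (M × N), x = (l.map fun p => tmul M N p.1 p.2).sum ∧
    r = (l.map fun p => ‖p.1‖ * ‖p.2‖).sum}

theorem costs_nonneg {x : AlgTensor M N} {r : ℝ} (hr : r ∈ costs x) : 0 ≤ r := by
  obtain ⟨l, -, rfl⟩ := hr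
  refine List.sum_nonneg fun a ha => ?_
  obtain ⟨p, -, rfl⟩ := List.mem_map.1 ha
  positivity

theorem costs_bddBelow (x : AlgTensor M N) : BddBelow (costs x) := ⟨0, fun _ => costs_nonneg⟩

theorem costs_add {x y : AlgTensor M N} {r s : ℝ} (hr : r ∈ costs x) (hs : s ∈ costs y) :
    r + s ∈ costs (x + y) := by
  obtain ⟨l, rfl, rfl⟩ := hr
  obtain ⟨k, rfl, rfl⟩ := hs
  exact ⟨l ++ k, by simp, by simp⟩

theorem costs_tmul (m : M) (n : N) : ‖m‖ * ‖n‖ ∈ costs (tmul M N m n) := ⟨[(m, n)], by simp, by simp⟩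

theorem costs_nonempty (x : AlgTensor M N) : (costs x).Nonempty := by
  refine TensorProduct.induction_on (R := R) (M := M) (N := N)
    (motive := fun x => (costs (M := M) (N := N) x).Nonempty) x ⟨0, [], rfl, rfl⟩
    (fun m n => ⟨_, costs_tmul m n⟩) ?_
  rintro x y ⟨r, hr⟩ ⟨s, hs⟩
  exact ⟨_, costs_add hr hs⟩

theorem costs_neg {x : AlgTensor M N} {r : ℝ} (hr : r ∈ costs x) : r ∈ costs (-x) := by
  obtain ⟨l, rfl, rfl⟩ := hr
  refine ⟨l.map fun p => (-p.1, p.2), ?_, by simp [Function.comp_def]⟩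
  induction l with
  | nil => simp
  | cons p l ih =>
    simp only [List.map_cons, List.sum_cons, neg_add, ih, map_neg, LinearMap.neg_apply]

/-- The projective seminorm `inf ∑ ‖mᵢ‖ ‖nᵢ‖`. -/
instance : Norm (AlgTensor M N) := ⟨fun x => sInf (costs x)⟩

theorem norm_def (x : AlgTensor M N) : ‖x‖ = sInf (costs x) := rfl

theorem norm_le_of_mem {x : AlgTensor M N} {r : ℝ} (hr : r ∈ costs x) : ‖x‖ ≤ r :=
  csInf_le (costs_bddBelow x) hr

theorem exists_cost_lt (x : AlgTensor M N) {ε : ℝ} (hε : 0 < ε) : ∃ r ∈ costs x, r < ‖x‖ + ε :=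
  exists_lt_of_csInf_lt (costs_nonempty x) (lt_add_of_pos_right _ hε)

instance : SeminormedAddCommGroup (AlgTensor M N) :=
  AddGroupSeminorm.toSeminormedAddCommGroup
    { toFun := fun x => ‖x‖
      map_zero' := le_antisymm (norm_le_of_mem ⟨[], rfl, rfl⟩)
        (Real.sInf_nonneg fun _ => costs_nonneg)
      add_le' := fun x y => le_of_forall_pos_le_add fun ε hε => by
        obtain ⟨r, hr, hr'⟩ := exists_cost_lt x (half_pos hε)
        obtain ⟨s, hs, hs'⟩ := exists_cost_lt y (half_pos hε)
        have := norm_le_of_mem (costs_add hr hs)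
        linarith
      neg' := fun x => by
        have h : ∀ y : AlgTensor M N, costs y ⊆ costs (-y) := fun y r => costs_neg
        rw [norm_def, norm_def, (h x).antisymm (by simpa using h (-x))] }

theorem norm_tmul_le (m : M) (n : N) : ‖tmul M N m n‖ ≤ ‖m‖ * ‖n‖ := norm_le_of_mem (costs_tmul m n)

/-- A linear map that is bounded on pure tensors is bounded. -/
theorem bound_of_tmul {E : Type*} [SeminormedAddCommGroup E] (f : AlgTensor M N →+ E) {C : ℝ}
    (hC : 0 ≤ C) (h : ∀ m n, ‖f (tmul M N m n)‖ ≤ C * (‖m‖ * ‖n‖)) (x : AlgTensor M N) :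
    ‖f x‖ ≤ C * ‖x‖ := by
  have key : ∀ r ∈ costs x, ‖f x‖ ≤ C * r := by
    rintro r ⟨l, rfl, rfl⟩
    induction l with
    | nil => simp
    | cons p l ih =>
      simp only [List.map_cons, List.sum_cons, map_add, mul_add]
      exact (norm_add_le _ _).trans (add_le_add (h _ _) ih)
  refine le_of_forall_pos_le_add fun ε hε => ?_
  obtain ⟨r, hr, hr'⟩ := exists_cost_lt x (ε := ε / (C + 1)) (by positivity)
  calc ‖f x‖ ≤ C * r := key r hr
    _ ≤ C * (‖x‖ + ε / (C + 1)) := mul_le_mul_of_nonneg_left hr'.le hC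
    _ ≤ C * ‖x‖ + ε := by
      rw [mul_add]
      gcongr
      rw [mul_div_assoc', div_le_iff₀ (by positivity)]
      nlinarith

theorem exists_norm_smul_le (M N : BanMod R) :
    ∃ C : ℝ, 0 < C ∧ ∀ (a : R) (x : AlgTensor M N), ‖a • x‖ ≤ C * ‖a‖ * ‖x‖ := by
  obtain ⟨C, hC, h⟩ := M.exists_norm_smul_le
  refine ⟨C, hC, fun a x => bound_of_tmul (DistribSMul.toAddMonoidHom (AlgTensor M N) a)
    (by positivity) (fun m n => ?_) x⟩
  have e : a • tmul M N m n = tmul M N (a • m) n := by simp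
  change ‖a • tmul M N m n‖ ≤ _
  rw [e, ← mul_assoc]
  exact (norm_tmul_le _ _).trans (mul_le_mul_of_nonneg_right (h a m) (norm_nonneg _))

instance : UniformContinuousConstSMul R (AlgTensor M N) where
  uniformContinuous_const_smul a := by
    obtain ⟨C, -, h⟩ := exists_norm_smul_le M N
    exact AddMonoidHomClass.uniformContinuous_of_bound
      (DistribSMul.toAddMonoidHom (AlgTensor M N) a) (C * ‖a‖) (h a)

end AlgTensor

/-- The completed projective tensor product: the separated completion of the algebraic tensor
product for the projective seminorm. -/
def tensorObj (M N : BanMod R) : BanMod R where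
  carrier := UniformSpace.Completion (AlgTensor M N)
  exists_norm_smul_le := by
    obtain ⟨C, hC, h⟩ := AlgTensor.exists_norm_smul_le M N
    refine ⟨C, hC, fun a x => ?_⟩
    induction x using UniformSpace.Completion.induction_on with
    | hp => exact isClosed_le (continuous_const_smul a).norm (continuous_const.mul continuous_norm)
    | ih x =>
      rw [← UniformSpace.Completion.coe_smul, UniformSpace.Completion.norm_coe,
        UniformSpace.Completion.norm_coe]
      exact h a x

section Tensor

variable {M N P : BanMod R}

/-- The pure tensor `m ⊗ n` in the completed tensor product. -/
def tmul (m : M) (n : N) : tensorObj M N :=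
  ((AlgTensor.tmul M N m n : AlgTensor M N) : UniformSpace.Completion (AlgTensor M N))

theorem norm_tmul_le (m : M) (n : N) : ‖tmul m n‖ ≤ ‖m‖ * ‖n‖ :=
  (UniformSpace.Completion.norm_coe _).trans_le (AlgTensor.norm_tmul_le m n)

/-- Pure tensors in the completed tensor product, as a bilinear map. -/
def tmulₗ (M N : BanMod R) : M →ₗ[R] N →ₗ[R] tensorObj M N :=
  LinearMap.mk₂ R tmul
    (fun m m' n => by simp only [tmul, map_add, LinearMap.add_apply, UniformSpace.Completion.coe_add]; rfl)
    (fun a m n => by simp only [tmul, map_smul, LinearMap.smul_apply, UniformSpace.Completion.coe_smul]; rfl)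
    (fun m n n' => by simp only [tmul, map_add, UniformSpace.Completion.coe_add]; rfl)
    (fun a m n => by simp only [tmul, map_smul, UniformSpace.Completion.coe_smul]; rfl)

/-- The bounded map on the completed tensor product induced by a bounded bilinear map. -/
def tensorLift (b : M →ₗ[R] N →ₗ[R] P) (hb : ∃ C : ℝ, 0 ≤ C ∧ ∀ m n, ‖b m n‖ ≤ C * (‖m‖ * ‖n‖)) :
    HomSpace (tensorObj M N) P :=
  let f : AlgTensor M N →ₗ[R] P := TensorProduct.lift b
  let F : NormedAddGroupHom (AlgTensor M N) P :=
    { toFun := f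
      map_add' := f.map_add
      bound' := by
        obtain ⟨C, hC, h⟩ := hb
        exact ⟨C, AlgTensor.bound_of_tmul f.toAddMonoidHom hC h⟩ }
  HomSpace.mk
    { toFun := F.extension
      map_add' := map_add F.extension
      map_smul' := fun a x => by
        refine UniformSpace.Completion.induction_on
          (p := fun x => F.extension (a • x) = a • F.extension x) x ?_ fun x => ?_
        · exact isClosed_eq (F.extension.continuous.comp (continuous_const_smul a))
            ((continuous_const_smul a).comp F.extension.continuous)
        · rw [← UniformSpace.Completion.coe_smul, NormedAddGroupHom.extension_coe,
            NormedAddGroupHom.extension_coe]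
          exact f.map_smul a x }
    ⟨‖F.extension‖, F.extension.le_opNorm⟩

@[simp] theorem tensorLift_tmul (b : M →ₗ[R] N →ₗ[R] P)
    (hb : ∃ C : ℝ, 0 ≤ C ∧ ∀ m n, ‖b m n‖ ≤ C * (‖m‖ * ‖n‖)) (m : M) (n : N) :
    tensorLift b hb (tmul m n) = b m n :=
  NormedAddGroupHom.extension_coe _ _

/-- Bounded maps out of the completed tensor product are determined by their values on pure
tensors. -/
theorem tensor_hom_ext {f g : HomSpace (tensorObj M N) P} (h : ∀ m n, f (tmul m n) = g (tmul m n)) :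
    f = g := by
  ext x
  refine UniformSpace.Completion.induction_on (p := fun x => f x = g x) x
    (isClosed_eq f.continuous g.continuous) fun x => ?_
  refine TensorProduct.induction_on (R := R) (M := M) (N := N)
    (motive := fun x => f (UniformSpace.Completion.coe' (α := AlgTensor M N) x) =
      g (UniformSpace.Completion.coe' (α := AlgTensor M N) x)) x ?_ h ?_
  · exact (map_zero f).trans (map_zero g).symm
  · intro x y hx hy
    exact (congrArg f (UniformSpace.Completion.coe_add (α := AlgTensor M N) x y)).trans <|
      (map_add f _ _).trans <| (congrArg₂ (· + ·) hx hy).trans <| (map_add g _ _).symm.trans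
        (congrArg g (UniformSpace.Completion.coe_add (α := AlgTensor M N) x y).symm)

end Tensor

/-- The map `f ⊗ g` on completed tensor products. -/
def tensorMap {M M' N N' : BanMod R} (f : HomSpace M M') (g : HomSpace N N') :
    HomSpace (tensorObj M N) (tensorObj M' N') :=
  tensorLift ((tmulₗ M' N').compl₁₂ f.1 g.1) ⟨‖f‖ * ‖g‖, by positivity, fun m n => by
    refine (norm_tmul_le (f m) (g n)).trans ?_
    calc ‖f m‖ * ‖g n‖ ≤ (‖f‖ * ‖m‖) * (‖g‖ * ‖n‖) :=
          mul_le_mul (f.le_norm m) (g.le_norm n) (norm_nonneg _) (by positivity)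
      _ = ‖f‖ * ‖g‖ * (‖m‖ * ‖n‖) := by ring⟩

@[simp] theorem tensorMap_tmul {M M' N N' : BanMod R} (f : HomSpace M M') (g : HomSpace N N')
    (m : M) (n : N) : tensorMap f g (tmul m n) = tmul (f m) (g n) :=
  tensorLift_tmul _ _ m n

theorem tensorMap_id (M N : BanMod R) :
    tensorMap (HomSpace.id M) (HomSpace.id N) = HomSpace.id (tensorObj M N) :=
  tensor_hom_ext fun m n => by simp

theorem tensorMap_comp {M M' M'' N N' N'' : BanMod R} (f : HomSpace M M') (f' : HomSpace M' M'')
    (g : HomSpace N N') (g' : HomSpace N' N'') :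
    tensorMap (HomSpace.comp f' f) (HomSpace.comp g' g) =
      HomSpace.comp (tensorMap f' g') (tensorMap f g) :=
  tensor_hom_ext fun m n => by simp

/-- The completed projective tensor product as a bifunctor. -/
abbrev tensor (R : Type u) [BanachRing R] : BanMod R ⥤ BanMod R ⥤ BanMod R where
  obj M :=
    { obj := fun N => tensorObj M N
      map := fun g => tensorMap (HomSpace.id M) g
      map_id := fun N => tensorMap_id M N
      map_comp := fun g g' => tensorMap_comp (HomSpace.id M) (HomSpace.id M) g g' }
  map f :=
    { app := fun N => tensorMap f (HomSpace.id N)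
      naturality := fun N N' g =>
        (tensorMap_comp (HomSpace.id _) f g (HomSpace.id N')).symm.trans
          (tensorMap_comp f (HomSpace.id _) (HomSpace.id N) g) }
  map_id M := NatTrans.ext (funext fun N => tensorMap_id M N)
  map_comp f f' := NatTrans.ext (funext fun N =>
    tensorMap_comp f f' (HomSpace.id N) (HomSpace.id N))

/-- The rank one map `m ↦ α(m) n`. -/
def rankOne {M N : BanMod R} (α : HomSpace M (unit R)) (n : N) : HomSpace M N :=
  HomSpace.mk ((LinearMap.toSpanSingleton R N n).comp α.1) (by
    obtain ⟨C, hC, h⟩ := N.exists_norm_smul_le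
    refine ⟨C * ‖α‖ * ‖n‖, fun m => (h (α m) n).trans ?_⟩
    calc C * ‖α m‖ * ‖n‖ ≤ C * (‖α‖ * ‖m‖) * ‖n‖ := by gcongr; exact α.le_norm m
      _ = C * ‖α‖ * ‖n‖ * ‖m‖ := by ring)

theorem rankOne_apply {M N : BanMod R} (α : HomSpace M (unit R)) (n : N) (m : M) :
    rankOne α n m = (show R from α m) • n := rfl

/-- The canonical map `M^∨ ⊗ N → Hom(M, N)`, `α ⊗ n ↦ (m ↦ α(m) n)`. -/
def dualTensorHom (M N : BanMod R) : HomSpace (tensorObj (dual M) N) (homObj M N) :=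
  tensorLift
    (LinearMap.mk₂ R (fun (α : HomSpace M (unit R)) (n : N) => (rankOne α n : HomSpace M N))
      (fun (α β : HomSpace M (unit R)) n => HomSpace.ext fun m =>
        add_smul (show R from α m) (show R from β m) n)
      (fun a (α : HomSpace M (unit R)) n => HomSpace.ext fun m =>
        mul_smul a (show R from α m) n)
      (fun (α : HomSpace M (unit R)) n n' => HomSpace.ext fun m =>
        smul_add (show R from α m) n n')
      (fun a (α : HomSpace M (unit R)) n => HomSpace.ext fun m =>
        smul_comm (show R from α m) a n))
    (by
      obtain ⟨C, hC, h⟩ := N.exists_norm_smul_le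
      refine ⟨C, hC.le, fun (α : HomSpace M (unit R)) n => HomSpace.norm_le ?_ fun m => ?_⟩
      · exact mul_nonneg hC.le (mul_nonneg α.nonneg (norm_nonneg _))
      · refine (h (α m) n).trans ?_
        calc C * ‖α m‖ * ‖n‖ ≤ C * (‖α‖ * ‖m‖) * ‖n‖ := by gcongr; exact α.le_norm m
          _ = C * (‖α‖ * ‖n‖) * ‖m‖ := by ring)

theorem dualTensorHom_tmul (M N : BanMod R) (α : HomSpace M (unit R)) (n : N) :
    dualTensorHom M N (tmul (M := dual M) α n) = rankOne α n :=
  tensorLift_tmul (M := dual M) (P := homObj M N) _ _ α n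

/-- The canonical map `M^∨ ⊗ N → Hom(M, N)` as a natural transformation in `N`. -/
def dualTensorHomNat (M : BanMod R) : (tensor R).obj (dual M) ⟶ ihom M where
  app N := dualTensorHom M N
  naturality N N' g := tensor_hom_ext fun (α : HomSpace M (unit R)) n => by
    change dualTensorHom M N' (tensorMap (HomSpace.id (dual M)) g (tmul (M := dual M) α n)) =
      homMap M g (dualTensorHom M N (tmul (M := dual M) α n))
    rw [tensorMap_tmul, dualTensorHom_tmul, HomSpace.id_apply, dualTensorHom_tmul]
    exact HomSpace.ext fun m => (HomSpace.map_smul g (show R from α m) n).symm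

/-! ### Zero object, kernels and cokernels -/

instance preadditive : Preadditive (BanMod R) where
  homGroup M N := inferInstanceAs (AddCommGroup (HomSpace M N))
  add_comp _ _ _ _ _ g := HomSpace.ext fun _ => map_add (show HomSpace _ _ from g) _ _
  comp_add _ _ _ _ _ _ := rfl

instance hasZeroObject : HasZeroObject (BanMod R) := by
  let Z : BanMod R :=
    { carrier := PUnit
      exists_norm_smul_le := ⟨1, one_pos, fun a m => by simp⟩ }
  have hZ : 𝟙 Z = 0 := HomSpace.ext fun m => rfl
  exact ⟨Z, (IsZero.iff_id_eq_zero Z).2 hZ⟩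

instance hasKernels : HasKernels (BanMod R) where
  has_limit {M N} f := by
    let f' : HomSpace M N := f
    have hc : IsClosed (LinearMap.ker f'.1 : Set M) := by
      have : (LinearMap.ker f'.1 : Set M) = f' ⁻¹' {0} := by ext; rfl
      rw [this]
      exact isClosed_singleton.preimage f'.continuous
    have : CompleteSpace (LinearMap.ker f'.1) := hc.completeSpace_coe
    let K : BanMod R :=
      { carrier := LinearMap.ker f'.1
        exists_norm_smul_le := by
          obtain ⟨C, hC, h⟩ := M.exists_norm_smul_le
          exact ⟨C, hC, fun a m => h a m⟩ }
    let ι : K ⟶ M := HomSpace.mk (M := K) (LinearMap.ker f'.1).subtype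
      ⟨1, fun m => (one_mul ‖m‖).ge⟩
    have w : ι ≫ f = 0 := HomSpace.ext fun m => m.2
    refine ⟨⟨⟨KernelFork.ofι ι w, ?_⟩⟩⟩
    refine KernelFork.IsLimit.ofι ι w
      (fun {T} (g : HomSpace T M) hg => HomSpace.mk (N := K)
        (g.1.codRestrict (LinearMap.ker f'.1) fun t => DFunLike.congr_fun (F := HomSpace T N) hg t)
        g.2)
      (fun {T} g hg => rfl) ?_
    intro T g hg l hl
    refine HomSpace.ext fun t => Subtype.ext ?_
    exact DFunLike.congr_fun (F := HomSpace T M) hl t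

instance hasCokernels : HasCokernels (BanMod R) where
  has_colimit {M N} f := by
    let f' : HomSpace M N := f
    let S : Submodule R N := (LinearMap.range f'.1).topologicalClosure
    have : IsClosed (S : Set N) := Submodule.isClosed_topologicalClosure _
    let Q : BanMod R :=
      { carrier := N ⧸ S
        exists_norm_smul_le := by
          obtain ⟨C, hC, h⟩ := N.exists_norm_smul_le
          refine ⟨C, hC, fun a x => le_of_forall_pos_le_add fun ε hε => ?_⟩
          obtain ⟨n, rfl, hn⟩ := Submodule.Quotient.norm_mk_lt x
            (ε := ε / (C * ‖a‖ + 1)) (by positivity)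
          calc ‖a • (Submodule.Quotient.mk n : N ⧸ S)‖
              ≤ ‖a • n‖ := Submodule.Quotient.norm_mk_le S (a • n)
            _ ≤ C * ‖a‖ * ‖n‖ := h a n
            _ ≤ C * ‖a‖ * (‖(Submodule.Quotient.mk n : N ⧸ S)‖ + ε / (C * ‖a‖ + 1)) :=
              mul_le_mul_of_nonneg_left hn.le (by positivity)
            _ ≤ C * ‖a‖ * ‖(Submodule.Quotient.mk n : N ⧸ S)‖ + ε := by
              rw [mul_add]
              gcongr
              rw [mul_div_assoc', div_le_iff₀ (by positivity)]
              nlinarith }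
    let π : N ⟶ Q := HomSpace.mk (N := Q) S.mkQ
      ⟨1, fun n => (Submodule.Quotient.norm_mk_le S n).trans (one_mul ‖n‖).ge⟩
    have w : f ≫ π = 0 := HomSpace.ext fun m => (Submodule.Quotient.mk_eq_zero S).2
      (Submodule.le_topologicalClosure _ ⟨m, rfl⟩)
    refine ⟨⟨⟨CokernelCofork.ofπ π w, ?_⟩⟩⟩
    have hS : ∀ {T : BanMod R} (g : HomSpace N T), f ≫ g = 0 → S ≤ LinearMap.ker g.1 := by
      intro T g hg
      refine Submodule.topologicalClosure_minimal _ ?_ ?_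
      · rintro _ ⟨m, rfl⟩
        exact DFunLike.congr_fun (F := HomSpace M T) hg m
      · have : (LinearMap.ker g.1 : Set N) = g ⁻¹' {0} := by ext; rfl
        rw [this]
        exact isClosed_singleton.preimage g.continuous
    refine CokernelCofork.IsColimit.ofπ π w
      (fun {T} (g : HomSpace N T) hg => HomSpace.mk (M := Q) (S.liftQ g.1 (hS g hg)) ?_)
      (fun {T} g hg => rfl) ?_
    · obtain ⟨C, hC, h⟩ := g.exists_bound
      refine ⟨C, fun x => le_of_forall_pos_le_add fun ε hε => ?_⟩
      obtain ⟨n, rfl, hn⟩ := Submodule.Quotient.norm_mk_lt (S := S) x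
        (ε := ε / (C + 1)) (by positivity)
      calc ‖g n‖ ≤ C * ‖n‖ := h n
        _ ≤ C * (‖(Submodule.Quotient.mk n : N ⧸ S)‖ + ε / (C + 1)) :=
          mul_le_mul_of_nonneg_left hn.le hC
        _ ≤ C * ‖(Submodule.Quotient.mk n : N ⧸ S)‖ + ε := by
          rw [mul_add]
          gcongr
          rw [mul_div_assoc', div_le_iff₀ (by positivity)]
          nlinarith
    · intro T g hg l hl
      refine HomSpace.ext fun x => ?_
      obtain ⟨n, rfl⟩ := Submodule.Quotient.mk_surjective S x
      exact DFunLike.congr_fun (F := HomSpace N T) hl n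

instance hasEqualizers : HasEqualizers (BanMod R) := Preadditive.hasEqualizers_of_hasKernels

instance hasCoequalizers : HasCoequalizers (BanMod R) := Preadditive.hasCoequalizers_of_hasCokernels

end BanMod

/-! ### Extension of functors to ind-objects -/

namespace IndExt

universe u v u' v'

variable {C : Type u} [Category.{v} C] {H : Type u'} [Category.{v'} H]
  [HasFilteredColimitsOfSize.{v, v} H]

/-- Left Kan extensions along `C ⥤ Ind C` exist and are pointwise: the value at `"colim" Vᵢ` is
`colim F(Vᵢ)`. -/
instance hasPointwiseLan (F : C ⥤ H) : (Ind.yoneda (C := C)).HasPointwiseLeftKanExtension F := by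
  intro V
  let e : CostructuredArrow Ind.yoneda V ≌ CostructuredArrow yoneda ((Ind.inclusion C).obj V) :=
    (CostructuredArrow.post Ind.yoneda (Ind.inclusion C) V).asEquivalence.trans
      (CostructuredArrow.mapNatIso Ind.yonedaCompInclusion)
  exact Functor.Final.hasColimit_of_comp (V.presentation.toCostructuredArrow ⋙ e.inverse)

instance hasFilteredColimits_functor {D : Type*} [Category* D] :
    HasFilteredColimitsOfSize.{v, v} (D ⥤ H) where
  HasColimitsOfShape _ _ _ := inferInstance

/-- The extension of a functor `F : C ⥤ H` to `Ind C`, given by `"colim" Vᵢ ↦ colim F(Vᵢ)`: the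
left Kan extension along `C ⥤ Ind C`. -/
abbrev extend : (C ⥤ H) ⥤ (Ind C ⥤ H) := (Ind.yoneda (C := C)).lan

/-- The extension restricts to the functor one started with. -/
def extendIso (F : C ⥤ H) : F ≅ Ind.yoneda ⋙ extend.obj F :=
  letI η : F ⟶ Ind.yoneda ⋙ extend.obj F := (Ind.yoneda (C := C)).leftKanExtensionUnit F
  have : IsIso η :=
    Functor.LeftExtension.IsPointwiseLeftKanExtension.isIso_hom
      (Functor.isPointwiseLeftKanExtensionLeftKanExtensionUnit Ind.yoneda F)
  asIso η

/-- The extension of an endofunctor of `C` to `Ind C`, given by `"colim" Vᵢ ↦ "colim" F(Vᵢ)`. -/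
abbrev extendEndo : (C ⥤ C) ⥤ (Ind C ⥤ Ind C) :=
  (Functor.whiskeringRight C C (Ind C)).obj Ind.yoneda ⋙ extend

/-- The extension of a bifunctor `t` on `C` to `Ind C`, given by
`("colim" Vᵢ, "colim" Wⱼ) ↦ "colim" t(Vᵢ, Wⱼ)`. -/
abbrev extendBi (t : C ⥤ C ⥤ C) : Ind C ⥤ Ind C ⥤ Ind C := extend.obj (t ⋙ extendEndo)

/-- For `A` in `C`, the functor `extendBi t A` is the extension of `t A`. -/
def extendBiIso (t : C ⥤ C ⥤ C) (A : C) :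
    (extendBi t).obj (Ind.yoneda.obj A) ≅ extendEndo.obj (t.obj A) :=
  ((extendIso (t ⋙ extendEndo)).app A).symm

open scoped ZeroObject in
instance hasZeroObject [HasZeroObject C] : HasZeroObject (Ind C) := by
  have hi : IsInitial (Ind.yoneda.obj (0 : C)) :=
    IsInitial.isInitialObj Ind.yoneda _ HasZeroObject.zeroIsInitial
  have ht : IsTerminal (Ind.yoneda.obj (0 : C)) :=
    IsTerminal.isTerminalObj Ind.yoneda _ HasZeroObject.zeroIsTerminal
  exact ⟨Ind.yoneda.obj 0, fun Y => ⟨⟨⟨hi.to Y⟩, fun f => hi.hom_ext _ _⟩⟩,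
    fun Y => ⟨⟨⟨ht.from Y⟩, fun f => ht.hom_ext _ _⟩⟩⟩

end IndExt

/-! ### Ind-Banach modules -/

/-- A strict monomorphism: a monomorphism whose comparison `coim f ⟶ im f` is an isomorphism, where
`im f = ker (coker f)` and `coim f = coker (ker f)`. -/
def IsStrictMono.{v, u} {E : Type u} [Category.{v} E] [HasZeroMorphisms E] [HasKernels E]
    [HasCokernels E] {X Y : E} (f : X ⟶ Y) : Prop :=
  Mono f ∧ IsIso (Abelian.coimageImageComparison f)

namespace IndBan

universe u

variable {R : Type u} [BanachRing R]

instance hasZeroMorphisms : HasZeroMorphisms (Ind (BanMod R)) :=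
  HasZeroObject.zeroMorphismsOfZeroObject

/-- The completed projective tensor product of ind-Banach modules,
`"colim" Vᵢ ⊗ "colim" Wⱼ = "colim" (Vᵢ ⊗ Wⱼ)`. -/
abbrev tensor (R : Type u) [BanachRing R] :
    Ind (BanMod R) ⥤ Ind (BanMod R) ⥤ Ind (BanMod R) :=
  IndExt.extendBi (BanMod.tensor R)

/-- The internal Hom from a Banach module to ind-Banach modules,
`Hom(W, "colim" Vᵢ) = "colim" Hom(W, Vᵢ)`. -/
abbrev ihom (W : BanMod R) : Ind (BanMod R) ⥤ Ind (BanMod R) :=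
  IndExt.extendEndo.obj (BanMod.ihom W)

/-- The natural morphism `W^∨ ⊗ V ⟶ Hom(W, V)`, for a Banach module `W`, natural in the
ind-Banach module `V`. -/
def dualTensorHom (W : BanMod R) :
    (tensor R).obj (Ind.yoneda.obj (BanMod.dual W)) ⟶ ihom W :=
  (IndExt.extendBiIso (BanMod.tensor R) (BanMod.dual W)).hom ≫
    IndExt.extendEndo.map (BanMod.dualTensorHomNat W)

/-- An ind-Banach module `V` is nuclear if `W^∨ ⊗ V ⟶ Hom(W, V)` is an isomorphism for every
Banach module `W`. -/
def IsNuclear (V : Ind (BanMod R)) : Prop :=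
  ∀ W : BanMod R, IsIso ((dualTensorHom W).app V)

/-- An ind-Banach module `F` is flat if the functor `(-) ⊗ F` preserves strict monomorphisms. -/
def IsFlat (F : Ind (BanMod R)) : Prop :=
  ∀ ⦃X Y : Ind (BanMod R)⦄ (f : X ⟶ Y), IsStrictMono f →
    IsStrictMono (((tensor R).map f).app F)

end IndBan

end

/-! For nuclear `V = "colim" Dⱼ`, the transition maps `u : Dⱼ ⟶ Dₖ` are eventually trace class: lift
the identity of `Dⱼ` along `Dⱼ^∨ ⊗ V ≅ Hom(Dⱼ, V)` to get `t ∈ Dⱼ^∨ ⊗ Dₖ` inducing `u`.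

For a Banach module `X`, the natural maps `X ⊗ Dⱼ ⟶ Hom(Dⱼ^∨, X)`, `x ⊗ w ↦ (α ↦ α(w) x)`, are then
invertible up to transition maps, the inverse being the contraction
`Hom(Dⱼ^∨, X) ⟶ X ⊗ Dₖ`, `h ↦ (h ⊗ id)(t)`. Hence `X ⊗ V ≅ "colim" Hom(Dⱼ^∨, X)`, naturally in `X`.
Each `Hom(Dⱼ^∨, -)` is a right adjoint and filtered colimits of ind-objects preserve equalizers, so
`(-) ⊗ V` preserves equalizers of Banach modules. As parallel pairs of ind-objects are formal
filtered colimits of parallel pairs of Banach modules, `(-) ⊗ V` preserves all equalizers. In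
particular it preserves kernels, and the strict monomorphisms are exactly the kernels. -/

noncomputable section

namespace IsStrictMono

universe v u v' u'

variable {E : Type u} [Category.{v} E] [HasZeroMorphisms E] [HasKernels E] [HasCokernels E]

theorem isIso_factorThruImage_of_normalMono {X Y : E} {f : X ⟶ Y} (h : NormalMono f) :
    IsIso (Abelian.factorThruImage f) := by
  have hg : Abelian.image.ι f ≫ h.g = 0 := by
    rw [← cokernel.π_desc f h.g h.w, kernel.condition_assoc, zero_comp]
  obtain ⟨s, hs⟩ := NormalMono.lift' f (Abelian.image.ι f) hg
  exact ⟨s, by rw [← cancel_mono f, Category.assoc, hs, Abelian.image.fac, Category.id_comp],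
    by rw [← cancel_mono (Abelian.image.ι f), Category.assoc, Abelian.image.fac, hs,
      Category.id_comp]⟩

theorem isIso_coimage_π_of_mono {X Y : E} (f : X ⟶ Y) [Mono f] : IsIso (Abelian.coimage.π f) :=
  cokernel.π_of_zero (by rw [← cancel_mono f, kernel.condition, zero_comp])

theorem coimage_π_comp_coimageImageComparison {X Y : E} (f : X ⟶ Y) :
    Abelian.coimage.π f ≫ Abelian.coimageImageComparison f = Abelian.factorThruImage f := by
  rw [← cancel_mono (Abelian.image.ι f), Category.assoc, Abelian.coimage_image_factorisation,
    Abelian.image.fac]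

theorem iff_nonempty_normalMono {X Y : E} {f : X ⟶ Y} :
    IsStrictMono f ↔ Nonempty (NormalMono f) := by
  have hπ := coimage_π_comp_coimageImageComparison f
  constructor
  · rintro ⟨_, _⟩
    have := isIso_coimage_π_of_mono f
    have : IsIso (Abelian.factorThruImage f) := hπ ▸ inferInstance
    let h : NormalMono (Abelian.image.ι f) :=
      ⟨_, cokernel.π f, kernel.condition _, kernelIsKernel _⟩
    exact ⟨NormalMono.ofArrowIso h
      (Arrow.isoMk (asIso (Abelian.factorThruImage f)).symm (Iso.refl _) (by simp))⟩
  · rintro ⟨h⟩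
    have := isIso_coimage_π_of_mono f
    have := isIso_factorThruImage_of_normalMono h
    rw [← hπ] at this
    exact ⟨inferInstance, IsIso.of_isIso_comp_left (Abelian.coimage.π f) _⟩

theorem map {E' : Type u'} [Category.{v'} E'] [HasZeroMorphisms E'] [HasKernels E']
    [HasCokernels E'] {X Y : E} {f : X ⟶ Y} (hf : IsStrictMono f) (G : E ⥤ E')
    [G.PreservesZeroMorphisms] [PreservesLimitsOfShape WalkingParallelPair G] :
    IsStrictMono (G.map f) := by
  obtain ⟨h⟩ := iff_nonempty_normalMono.mp hf
  exact iff_nonempty_normalMono.mpr ⟨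
    { Z := G.obj h.Z
      g := G.map h.g
      w := by rw [← G.map_comp, h.w, G.map_zero]
      isLimit := KernelFork.mapIsLimit _ h.isLimit G }⟩

end IsStrictMono

namespace IndExt

universe v u v' u'

variable {C : Type u} [Category.{v} C]

instance isFinitelyPresentable_yoneda (P : C) :
    IsFinitelyPresentable.{v} (Ind.yoneda.obj P : Ind C) := by
  let i : (Ind.inclusion C).obj (Ind.yoneda.obj P) ≅ yoneda.obj P := Ind.yonedaCompInclusion.app P
  let e : Ind.inclusion C ⋙ (evaluation Cᵒᵖ (Type v)).obj (.op P) ≅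
      coyoneda.obj (.op (Ind.yoneda.obj P : Ind C)) :=
    NatIso.ofComponents (fun V => (yonedaEquiv.symm.trans ((i.homCongr (Iso.refl _)).symm.trans
      (Ind.inclusion.fullyFaithful.homEquiv (X := Ind.yoneda.obj P) (Y := V)).symm)).toIso)
      (fun {V W} f => by
        ext x
        apply (Ind.inclusion C).map_injective
        simp [Functor.FullyFaithful.homEquiv, yonedaEquiv_symm_naturality_right])
  rw [isFinitelyPresentable_iff_preservesFilteredColimits]
  exact ⟨fun J _ _ => preservesColimitsOfShape_of_natIso e⟩

/-- The canonical morphism from `A j` to `"colim" A`. -/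
def limι {J : Type v} [SmallCategory J] [IsFiltered J] (A : J ⥤ C) (j : J) :
    Ind.yoneda.obj (A.obj j) ⟶ (Ind.lim J).obj A :=
  colimit.ι (A ⋙ Ind.yoneda) j

theorem limι_map {J : Type v} [SmallCategory J] [IsFiltered J] {A B : J ⥤ C} (φ : A ⟶ B) (j : J) :
    limι A j ≫ (Ind.lim J).map φ = Ind.yoneda.map (φ.app j) ≫ limι B j :=
  colimit.ι_map (Functor.whiskerRight φ Ind.yoneda) j

section Extend

variable {I : Type v} [SmallCategory I] {D : I ⥤ C} {c : Cocone (D ⋙ Ind.yoneda)}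

/-- For a cocone `c` over `D i`, the functor `i ↦ (D i ⟶ c.pt)` to the objects of `C` over the
ind-object `c.pt`. -/
def toCostructuredArrow (c : Cocone (D ⋙ Ind.yoneda)) : I ⥤ CostructuredArrow Ind.yoneda c.pt :=
  c.toCostructuredArrow ⋙ CostructuredArrow.pre D Ind.yoneda c.pt

theorem final_toCostructuredArrow [IsFiltered I] (hc : IsColimit c) :
    (toCostructuredArrow c).Final := by
  refine Functor.final_of_exists_of_isFiltered _ (fun d => ?_) (fun {d i} s s' => ?_)
  · obtain ⟨i, p, hp⟩ := IsFinitelyPresentable.exists_hom_of_isColimit hc d.hom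
    obtain ⟨p, rfl⟩ := Ind.yoneda.map_surjective p
    exact ⟨i, ⟨CostructuredArrow.homMk p hp⟩⟩
  · obtain ⟨k, a, h⟩ := exists_eq_of_preservesColimit_coyoneda_self hc
      (Ind.yoneda.map s.left) (Ind.yoneda.map s'.left)
      ((CostructuredArrow.w s).trans (CostructuredArrow.w s').symm)
    refine ⟨k, a, CostructuredArrow.hom_ext _ _ (Ind.yoneda.map_injective ?_)⟩
    exact (Ind.yoneda.map_comp _ _).trans (h.trans (Ind.yoneda.map_comp _ _).symm)

variable {H : Type u'} [Category.{v'} H] [HasFilteredColimitsOfSize.{v, v} H]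

/-- The cocone exhibiting the value of the extension of `F` at `"colim" Dᵢ` as `colim F(Dᵢ)`. -/
def extendCocone (F : C ⥤ H) (c : Cocone (D ⋙ Ind.yoneda)) : Cocone (D ⋙ F) :=
  (Cocone.precompose (Functor.whiskerLeft D (extendIso F).hom)).obj ((extend.obj F).mapCocone c)

/-- The extension of `F` sends `"colim" Dᵢ` to `colim F(Dᵢ)`. -/
def isColimitExtendCocone [IsFiltered I] (F : C ⥤ H) (hc : IsColimit c) :
    IsColimit (extendCocone F c) :=
  have := final_toCostructuredArrow hc
  (Functor.Final.isColimitWhiskerEquiv (toCostructuredArrow c) _).symm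
    (Functor.isPointwiseLeftKanExtensionLeftKanExtensionUnit Ind.yoneda F c.pt)

theorem extendCocone_ι_map {F G : C ⥤ H} (τ : F ⟶ G) (i : I) :
    (extendCocone F c).ι.app i ≫ (extend.map τ).app c.pt =
      τ.app (D.obj i) ≫ (extendCocone G c).ι.app i := by
  have h : (extendIso F).hom.app (D.obj i) ≫ (extend.map τ).app (Ind.yoneda.obj (D.obj i)) =
      τ.app (D.obj i) ≫ (extendIso G).hom.app (D.obj i) :=
    (NatTrans.congr_app (((Ind.yoneda (C := C)).lanUnit (H := H)).naturality τ) (D.obj i)).symm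
  calc _ = (extendIso F).hom.app (D.obj i) ≫ (extend.map τ).app (Ind.yoneda.obj (D.obj i)) ≫
        (extend.obj G).map (c.ι.app i) :=
      (Category.assoc _ _ _).trans (congrArg _ ((extend.map τ).naturality (c.ι.app i)))
    _ = _ := (Category.assoc _ _ _).symm.trans ((h =≫ _).trans (Category.assoc _ _ _))

theorem preservesColimit_extend [IsFiltered I] (F : C ⥤ H) (D : I ⥤ C) :
    PreservesColimit (D ⋙ Ind.yoneda) (extend.obj F) :=
  preservesColimit_of_preserves_colimit_cocone (colimit.isColimit _) <|
    IsColimit.precomposeHomEquiv (Functor.isoWhiskerLeft D (extendIso F)) _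
      (isColimitExtendCocone F (colimit.isColimit _))

/-- The value of the extension of an endofunctor `F` at `"colim" Dᵢ` is `"colim" F(Dᵢ)`. -/
def extendEndoObjObjIso [IsFiltered I] (hc : IsColimit c) (F : C ⥤ C) :
    (extendEndo.obj F).obj c.pt ≅ (Ind.lim I).obj (D ⋙ F) :=
  (isColimitExtendCocone (F ⋙ Ind.yoneda) hc).coconePointUniqueUpToIso
    (colimit.isColimit (D ⋙ F ⋙ Ind.yoneda))

theorem extendCocone_ι_extendEndoObjObjIso_hom [IsFiltered I] (hc : IsColimit c) (F : C ⥤ C)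
    (i : I) : (extendCocone (F ⋙ Ind.yoneda) c).ι.app i ≫ (extendEndoObjObjIso hc F).hom =
      limι (D ⋙ F) i :=
  (isColimitExtendCocone (F ⋙ Ind.yoneda) hc).comp_coconePointUniqueUpToIso_hom
    (colimit.isColimit (D ⋙ F ⋙ Ind.yoneda)) i

theorem extendEndoObjObjIso_naturality [IsFiltered I] (hc : IsColimit c) {F G : C ⥤ C}
    (τ : F ⟶ G) : (extendEndo.map τ).app c.pt ≫ (extendEndoObjObjIso hc G).hom =
      (extendEndoObjObjIso hc F).hom ≫ (Ind.lim I).map (Functor.whiskerLeft D τ) := by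
  refine (isColimitExtendCocone (F ⋙ Ind.yoneda) hc).hom_ext fun i => ?_
  have hF := extendCocone_ι_extendEndoObjObjIso_hom hc F i
  have hG := extendCocone_ι_extendEndoObjObjIso_hom hc G i
  have hτ := extendCocone_ι_map (c := c) (Functor.whiskerRight τ Ind.yoneda) i
  exact (Category.assoc _ _ _).symm.trans <| (hτ =≫ _).trans <| (Category.assoc _ _ _).trans <|
    (_ ≫= hG).trans <| (limι_map (Functor.whiskerLeft D τ) i).symm.trans <|
    (hF =≫ _).symm.trans (Category.assoc _ _ _)

/-- The value of the extension of an endofunctor `F` at `"colim" Dᵢ` is `"colim" F(Dᵢ)`, naturally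
in `F`. -/
def extendEndoObjIso [IsFiltered I] (hc : IsColimit c) :
    extendEndo ⋙ (evaluation (Ind C) (Ind C)).obj c.pt ≅
      (Functor.whiskeringLeft I C C).obj D ⋙ Ind.lim I :=
  NatIso.ofComponents (extendEndoObjObjIso hc) (extendEndoObjObjIso_naturality hc)

end Extend

theorem isIso_colimMap_of_interleaving {E : Type u'} [Category.{v'} E] {J : Type u} [Category.{v} J]
    [IsFiltered J] {A B : J ⥤ E} [HasColimit A] [HasColimit B] (φ : A ⟶ B)
    (h : ∀ j, ∃ (k : J) (f : j ⟶ k) (s : B.obj j ⟶ A.obj k),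
      φ.app j ≫ s = A.map f ∧ s ≫ φ.app k = B.map f) : IsIso (colimMap φ) := by
  choose k f s hφs hsφ using h
  let t (j : J) : B.obj j ⟶ colimit A := s j ≫ colimit.ι A (k j)
  have hφt (j : J) : φ.app j ≫ t j = colimit.ι A j := by
    rw [reassoc_of% hφs j, colimit.w]
  have ht (j : J) {m : J} (x : k j ⟶ m) : t j = B.map (f j ≫ x) ≫ t m := by
    rw [B.map_comp, ← hsφ, Category.assoc, Category.assoc, ← φ.naturality_assoc, hφt, colimit.w]
  have htw {j l : J} (g : j ⟶ l) : B.map g ≫ t l = t j := by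
    obtain ⟨m, x, y, hxy⟩ := IsFiltered.span (f j) (g ≫ f l)
    rw [ht j x, ht l y, hxy, ← B.map_comp_assoc, Category.assoc]
  refine ⟨colimit.desc B ⟨_, { app := t, naturality := fun _ _ g => by simp [htw] }⟩, ?_, ?_⟩
  · ext j
    simp [hφt]
  · ext j
    simp [t, reassoc_of% hsφ j]

theorem exists_lift_of_isIso_lim_map {J : Type v} [SmallCategory J] [IsFiltered J] {A B : J ⥤ C}
    (φ : A ⟶ B) [IsIso ((Ind.lim J).map φ)] {P : C} {j : J} (x : P ⟶ B.obj j) :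
    ∃ (k : J) (f : j ⟶ k) (y : P ⟶ A.obj k), y ≫ φ.app k = x ≫ B.map f := by
  obtain ⟨i, y, hy⟩ : ∃ (i : J) (y : Ind.yoneda.obj P ⟶ Ind.yoneda.obj (A.obj i)),
      y ≫ limι A i = Ind.yoneda.map x ≫ limι B j ≫ inv ((Ind.lim J).map φ) :=
    IsFinitelyPresentable.exists_hom_of_isColimit (colimit.isColimit (A ⋙ Ind.yoneda)) _
  obtain ⟨y, rfl⟩ := Ind.yoneda.map_surjective y
  have hxy : Ind.yoneda.map (y ≫ φ.app i) ≫ limι B i = Ind.yoneda.map x ≫ limι B j := by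
    rw [Functor.map_comp, Category.assoc, ← limι_map, reassoc_of% hy, IsIso.inv_hom_id,
      Category.comp_id]
  obtain ⟨k, g, f, h⟩ := IsFinitelyPresentable.exists_eq_of_isColimit
    (colimit.isColimit (B ⋙ Ind.yoneda)) _ _ hxy
  refine ⟨k, f, y ≫ A.map g, Ind.yoneda.map_injective ?_⟩
  rw [Category.assoc, φ.naturality, ← Category.assoc, Functor.map_comp, Functor.map_comp _ x]
  exact h

/-- A functor on ind-objects commuting with the formal colimits sends the formal colimit of a
diagram `D` in `C` to the colimit of its values on `D`, naturally in `D`. -/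
def limCompIso {H : Type u'} [Category.{v'} H] [HasFilteredColimitsOfSize.{v, v} H]
    (G : Ind C ⥤ H) (I : Type v) [SmallCategory I] [IsFiltered I]
    [∀ D : I ⥤ C, PreservesColimit (D ⋙ Ind.yoneda) G] :
    (Functor.whiskeringRight I C H).obj (Ind.yoneda ⋙ G) ⋙ colim ≅ Ind.lim I ⋙ G :=
  NatIso.ofComponents (fun D => (preservesColimitIso G (D ⋙ Ind.yoneda)).symm)
    (fun f => (colimit.map_post (Functor.whiskerRight f Ind.yoneda) G).symm)

theorem exists_parallelPair_iso_comp_lim {X Y : Ind C} (f g : X ⟶ Y) :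
    ∃ (I : Type v) (_ : SmallCategory I) (_ : IsFiltered I) (A B : I ⥤ C) (φ ψ : A ⟶ B),
      Nonempty (parallelPair f g ≅ parallelPair φ ψ ⋙ Ind.lim I) := by
  obtain ⟨P⟩ := nonempty_indParallelPairPresentation X.2 Y.2
    ((Ind.inclusion C).map f) ((Ind.inclusion C).map g)
  exact ⟨P.I, P.ℐ, P.hI, P.F₁, P.F₂, P.φ, P.ψ,
    ⟨P.parallelPairIsoParallelPairCompIndYoneda⟩⟩

instance preservesEqualizers_colim [HasEqualizers C] {I : Type v} [SmallCategory I] [IsFiltered I] :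
    PreservesLimitsOfShape WalkingParallelPair (colim : (I ⥤ Ind C) ⥤ Ind C) :=
  have : PreservesLimitsOfShape WalkingParallelPair
      ((colim : (I ⥤ Ind C) ⥤ Ind C) ⋙ Ind.inclusion C) :=
    preservesLimitsOfShape_of_natIso (preservesColimitNatIso (J := I) (Ind.inclusion C)).symm
  preservesLimitsOfShape_of_reflects_of_preserves _ (Ind.inclusion C)

theorem preservesEqualizers_of_yoneda_comp [HasEqualizers C] {H : Type u'} [Category.{v'} H]
    [HasFilteredColimitsOfSize.{v, v} H] (G : Ind C ⥤ H)
    (hH : ∀ (I : Type v) [SmallCategory I] [IsFiltered I],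
      PreservesLimitsOfShape WalkingParallelPair (colim : (I ⥤ H) ⥤ H))
    (hG : ∀ (I : Type v) [SmallCategory I] [IsFiltered I] (D : I ⥤ C),
      PreservesColimit (D ⋙ Ind.yoneda) G)
    [PreservesLimitsOfShape WalkingParallelPair (Ind.yoneda ⋙ G)] :
    PreservesLimitsOfShape WalkingParallelPair G := by
  have (I : Type v) [SmallCategory I] [IsFiltered I] :
      PreservesLimitsOfShape WalkingParallelPair (Ind.lim I ⋙ G) :=
    have := hH I
    have := hG I
    preservesLimitsOfShape_of_natIso (limCompIso G I)
  refine ⟨fun {K} => ?_⟩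
  obtain ⟨I, _, _, A, B, φ, ψ, ⟨e⟩⟩ := exists_parallelPair_iso_comp_lim
    (K.map WalkingParallelPairHom.left) (K.map WalkingParallelPairHom.right)
  let F := parallelPair φ ψ
  have : PreservesLimit (F ⋙ Ind.lim I) G :=
    preservesLimit_of_preserves_limit_cone
      (isLimitOfPreserves (Ind.lim I) (limit.isLimit F))
      (isLimitOfPreserves (Ind.lim I ⋙ G) (limit.isLimit F))
  exact preservesLimit_of_iso_diagram G
    (diagramIsoParallelPair K ≪≫ e).symm

instance preservesZeroMorphisms_lim [HasZeroMorphisms C] [HasZeroMorphisms (Ind C)]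
    {I : Type v} [SmallCategory I] [IsFiltered I] :
    (Ind.lim I : (I ⥤ C) ⥤ Ind C).PreservesZeroMorphisms :=
  inferInstanceAs ((Functor.whiskeringRight _ _ _).obj Ind.yoneda ⋙ colim).PreservesZeroMorphisms

theorem preservesZeroMorphisms_of_yoneda_comp [HasZeroMorphisms C] [HasZeroObject C]
    [HasZeroMorphisms (Ind C)] {H : Type u'} [Category.{v'} H] [HasZeroMorphisms H]
    [HasZeroObject H] (G : Ind C ⥤ H) [(Ind.yoneda ⋙ G).PreservesZeroMorphisms] :
    G.PreservesZeroMorphisms :=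
  G.preservesZeroMorphisms_of_map_zero_object
    (G.mapIso (Ind.yoneda (C := C)).mapZeroObject.symm ≪≫ (Ind.yoneda ⋙ G).mapZeroObject)

end IndExt

namespace BanMod

universe u

variable {R : Type u} [BanachRing R]

theorem norm_tensorLift_le {M N P : BanMod R} (b : M →ₗ[R] N →ₗ[R] P) {C : ℝ} (hC : 0 ≤ C)
    (hb : ∀ m n, ‖b m n‖ ≤ C * (‖m‖ * ‖n‖)) : ‖tensorLift b ⟨C, hC, hb⟩‖ ≤ C := by
  refine HomSpace.norm_le hC fun x => UniformSpace.Completion.induction_on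
    (p := fun x => ‖tensorLift b ⟨C, hC, hb⟩ x‖ ≤ C * ‖x‖) x ?_ fun x => ?_
  · exact isClosed_le (HomSpace.continuous (tensorLift b ⟨C, hC, hb⟩)).norm
      (continuous_const.mul continuous_norm)
  · rw [UniformSpace.Completion.norm_coe]
    refine (congrArg norm (NormedAddGroupHom.extension_coe _ x)).trans_le ?_
    exact AlgTensor.bound_of_tmul (TensorProduct.lift b).toAddMonoidHom hC hb x

theorem norm_tensorMap_le {M M' N N' : BanMod R} (f : HomSpace M M') (g : HomSpace N N') :
    ‖tensorMap f g‖ ≤ ‖f‖ * ‖g‖ :=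
  norm_tensorLift_le ((tmulₗ M' N').compl₁₂ f.1 g.1) (mul_nonneg f.nonneg g.nonneg) fun m n =>
    calc ‖tmul (f m) (g n)‖ ≤ ‖f m‖ * ‖g n‖ := norm_tmul_le _ _
      _ ≤ (‖f‖ * ‖m‖) * (‖g‖ * ‖n‖) :=
        mul_le_mul (f.le_norm m) (g.le_norm n) (norm_nonneg _)
          (mul_nonneg f.nonneg (norm_nonneg m))
      _ = ‖f‖ * ‖g‖ * (‖m‖ * ‖n‖) := by ring

/-- The currying `Hom(M ⊗ N, P) → Hom(N, Hom(M, P))`. -/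
def curry {M N P : BanMod R} (f : HomSpace (tensorObj M N) P) : HomSpace N (homObj M P) :=
  have bound (n : N) (m : M) : ‖f (tmul m n)‖ ≤ ‖f‖ * ‖n‖ * ‖m‖ :=
    calc ‖f (tmul m n)‖ ≤ ‖f‖ * (‖m‖ * ‖n‖) := (f.le_norm _).trans <|
          mul_le_mul_of_nonneg_left (norm_tmul_le m n) f.nonneg
      _ = ‖f‖ * ‖n‖ * ‖m‖ := by ring
  HomSpace.mk (N := homObj M P)
    { toFun := fun n =>
        (HomSpace.mk (f.1.comp ((tmulₗ M N).flip n)) ⟨_, bound n⟩ : HomSpace M P)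
      map_add' := fun n n' => HomSpace.ext fun m => LinearMap.map_add (f.1.comp (tmulₗ M N m)) n n'
      map_smul' := fun a n => HomSpace.ext fun m =>
        LinearMap.map_smul (f.1.comp (tmulₗ M N m)) a n }
    ⟨‖f‖, fun n => HomSpace.norm_le (mul_nonneg f.nonneg (norm_nonneg n)) (bound n)⟩

theorem curry_apply {M N P : BanMod R} (f : HomSpace (tensorObj M N) P) (n : N) (m : M) :
    (show HomSpace M P from curry f n) m = f (tmul m n) := rfl

/-- The uncurrying `Hom(N, Hom(M, P)) → Hom(M ⊗ N, P)`. -/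
def uncurry {M N P : BanMod R} (g : HomSpace N (homObj M P)) : HomSpace (tensorObj M N) P :=
  tensorLift
    (LinearMap.mk₂ R (fun m n => (show HomSpace M P from g n) m)
      (fun m m' n => map_add (show HomSpace M P from g n) m m')
      (fun a m n => HomSpace.map_smul (show HomSpace M P from g n) a m)
      (fun m n n' => DFunLike.congr_fun (F := HomSpace M P) (map_add g n n') m)
      (fun a m n => DFunLike.congr_fun (F := HomSpace M P) (g.map_smul a n) m))
    ⟨‖g‖, g.nonneg, fun m n =>
      calc ‖(show HomSpace M P from g n) m‖ ≤ ‖g n‖ * ‖m‖ := HomSpace.le_norm (g n) m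
        _ ≤ ‖g‖ * ‖n‖ * ‖m‖ := mul_le_mul_of_nonneg_right (g.le_norm n) (norm_nonneg m)
        _ = ‖g‖ * (‖m‖ * ‖n‖) := by ring⟩

theorem uncurry_tmul {M N P : BanMod R} (g : HomSpace N (homObj M P)) (m : M) (n : N) :
    uncurry g (tmul m n) = (show HomSpace M P from g n) m :=
  tensorLift_tmul _ _ m n

/-- The tensor-hom adjunction `M ⊗ (-) ⊣ Hom(M, -)`. -/
def tensorIhomAdjunction (M : BanMod R) : (tensor R).obj M ⊣ ihom M :=
  Adjunction.mkOfHomEquiv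
    { homEquiv := fun N P =>
        { toFun := fun f => curry f
          invFun := fun g => uncurry g
          left_inv := fun f => tensor_hom_ext fun m n => uncurry_tmul (curry f) m n
          right_inv := fun g => HomSpace.ext fun n => HomSpace.ext fun m => uncurry_tmul g m n }
      homEquiv_naturality_left_symm := fun f g => tensor_hom_ext fun m n => by
        refine (uncurry_tmul _ m n).trans (Eq.symm ?_)
        exact (congrArg (uncurry g) (tensorMap_tmul (HomSpace.id M) f m n)).trans
          (uncurry_tmul g m _)
      homEquiv_naturality_right := fun _ _ => rfl }

instance isRightAdjoint_ihom (M : BanMod R) : (ihom M).IsRightAdjoint :=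
  (tensorIhomAdjunction M).isRightAdjoint

/-- The symmetry `M ⊗ N → N ⊗ M`. -/
def tensorSwap (M N : BanMod R) : HomSpace (tensorObj M N) (tensorObj N M) :=
  tensorLift (tmulₗ N M).flip ⟨1, zero_le_one, fun m n =>
    (norm_tmul_le n m).trans_eq (by rw [one_mul, mul_comm])⟩

theorem tensorSwap_tmul {M N : BanMod R} (m : M) (n : N) :
    tensorSwap M N (tmul m n) = tmul n m :=
  tensorLift_tmul _ _ m n

/-- The evaluation `M → Hom(Hom(M, N), N)`, `m ↦ (f ↦ f(m))`. -/
def eval (M N : BanMod R) : HomSpace M (homObj (homObj M N) N) :=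
  curry (HomSpace.comp (uncurry (HomSpace.id (homObj M N))) (tensorSwap (homObj M N) M))

theorem eval_apply {M N : BanMod R} (m : M) (f : HomSpace M N) :
    (show HomSpace (homObj M N) N from eval M N m) f = f m := by
  refine (curry_apply _ m _).trans ?_
  rw [HomSpace.comp_apply, tensorSwap_tmul, uncurry_tmul]
  rfl

/-- Precomposition with `f : M → N`, as a bounded map `Hom(N, P) → Hom(M, P)`. -/
def precomp {M N : BanMod R} (f : HomSpace M N) (P : BanMod R) :
    HomSpace (homObj N P) (homObj M P) :=
  curry (HomSpace.comp (uncurry (HomSpace.id (homObj N P))) (tensorMap f (HomSpace.id _)))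

theorem precomp_apply {M N P : BanMod R} (f : HomSpace M N) (g : HomSpace N P) :
    precomp f P g = HomSpace.comp g f := by
  refine HomSpace.ext fun m => (curry_apply (M := M) (N := homObj N P) _ g m).trans ?_
  rw [HomSpace.comp_apply, tensorMap_tmul, uncurry_tmul]
  rfl

theorem precomp_precomp_apply {W V P X : BanMod R} (u : HomSpace W V)
    (h : HomSpace (homObj W P) X) (α : HomSpace V P) :
    (show HomSpace (homObj V P) X from precomp (precomp u P) X h) α = h (HomSpace.comp α u) :=
  (DFunLike.congr_fun (F := HomSpace _ _) (precomp_apply (precomp u P) h) α).trans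
    (congrArg h (precomp_apply u α))

/-- The bifunctor `(W, X) ↦ Hom(W^∨, X)`, covariant in both variables. -/
def ihomDual (R : Type u) [BanachRing R] : BanMod R ⥤ BanMod R ⥤ BanMod R where
  obj W := ihom (dual W)
  map u :=
    { app := fun X => precomp (precomp u (unit R)) X
      naturality := fun X Y g => HomSpace.ext fun h : HomSpace (dual _) X =>
        (precomp_apply _ (HomSpace.comp g h)).trans
          (congrArg (homMap _ g) (precomp_apply _ h)).symm }
  map_id W := NatTrans.ext <| funext fun X => HomSpace.ext fun h : HomSpace (dual W) X =>
    HomSpace.ext fun α : HomSpace W (unit R) => precomp_precomp_apply (HomSpace.id W) h α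
  map_comp {W₁ W₂ W₃} u v := NatTrans.ext <| funext fun X =>
    HomSpace.ext fun h : HomSpace (dual W₁) X => HomSpace.ext fun α : HomSpace W₃ (unit R) => by
      refine (precomp_precomp_apply _ h α).trans (Eq.symm ?_)
      exact (precomp_precomp_apply v _ α).trans (precomp_precomp_apply u h _)

instance preservesEqualizers_flip_ihomDual {J : Type*} [Category* J] (D : J ⥤ BanMod R) :
    PreservesLimitsOfShape WalkingParallelPair (D ⋙ ihomDual R).flip :=
  preservesLimitsOfShape_of_evaluation _ _ fun j =>
    inferInstanceAs (PreservesLimitsOfShape _ (ihom (dual (D.obj j))))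

instance preservesZeroMorphisms_flip_ihomDual {J : Type*} [Category* J] (D : J ⥤ BanMod R) :
    (D ⋙ ihomDual R).flip.PreservesZeroMorphisms where
  map_zero X Y := NatTrans.ext <| funext fun j => (ihom (dual (D.obj j))).map_zero X Y

/-- The natural map `X ⊗ W → Hom(W^∨, X)`, `x ⊗ w ↦ (α ↦ α(w) x)`. -/
def tensorDualHom (X W : BanMod R) : HomSpace (tensorObj X W) (homObj (dual W) X) :=
  HomSpace.comp (dualTensorHom (dual W) X)
    (HomSpace.comp (tensorMap (eval W (unit R)) (HomSpace.id X)) (tensorSwap X W))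

theorem tensorDualHom_tmul {X W : BanMod R} (x : X) (w : W) :
    tensorDualHom X W (tmul x w) = rankOne (M := dual W) (eval W (unit R) w) x := by
  rw [tensorDualHom, HomSpace.comp_apply, HomSpace.comp_apply, tensorSwap_tmul, tensorMap_tmul]
  exact dualTensorHom_tmul _ _ _ _

theorem tensorDualHom_tmul_apply {X W : BanMod R} (x : X) (w : W) (α : HomSpace W (unit R)) :
    (show HomSpace (dual W) X from tensorDualHom X W (tmul x w)) α = (show R from α w) • x := by
  rw [tensorDualHom_tmul]
  exact congrArg (fun r : R => r • x) (eval_apply w α)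

theorem tensorDualHom_tensorMap_tmul_apply {M N X W : BanMod R} (f : HomSpace M X)
    (g : HomSpace N W) (m : M) (n : N) (α : HomSpace W (unit R)) :
    (show HomSpace (dual W) X from tensorDualHom X W (tensorMap f g (tmul m n))) α =
      (show R from α (g n)) • f m := by
  rw [tensorMap_tmul]
  exact tensorDualHom_tmul_apply (f m) (g n) α

/-- The maps `tensorDualHom` as a natural transformation in both variables. -/
def tensorDualHomNat (R : Type u) [BanachRing R] : tensor R ⟶ (ihomDual R).flip where
  app X :=
    { app := fun W => tensorDualHom X W
      naturality := fun _ V u => tensor_hom_ext fun x w =>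
        HomSpace.ext fun β : HomSpace V (unit R) =>
          (tensorDualHom_tensorMap_tmul_apply _ u x w β).trans <|
            ((precomp_precomp_apply u _ β).trans
              (tensorDualHom_tmul_apply x w (HomSpace.comp β u))).symm }
  naturality _ _ f := NatTrans.ext <| funext fun W => tensor_hom_ext fun x w =>
    HomSpace.ext fun α : HomSpace W (unit R) =>
      (tensorDualHom_tensorMap_tmul_apply f _ x w α).trans <|
        ((congrArg f (tensorDualHom_tmul_apply x w α)).trans (HomSpace.map_smul f _ x)).symm

/-- The bounded map `Hom(M, N) → Hom(M ⊗ P, N ⊗ P)`, `h ↦ h ⊗ id`. -/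
def rTensor (M N P : BanMod R) :
    HomSpace (homObj M N) (homObj (tensorObj M P) (tensorObj N P)) :=
  HomSpace.mk (M := homObj M N) (N := homObj (tensorObj M P) (tensorObj N P))
    { toFun := fun h : HomSpace M N => tensorMap h (HomSpace.id P)
      map_add' := fun (g h : HomSpace M N) => tensor_hom_ext fun m p => by
        rw [HomSpace.add_apply]
        simp only [tensorMap_tmul]
        exact LinearMap.map_add₂ (tmulₗ N P) (g m) (h m) p
      map_smul' := fun a (h : HomSpace M N) => tensor_hom_ext fun m p => by
        rw [RingHom.id_apply, HomSpace.smul_apply]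
        simp only [tensorMap_tmul]
        exact LinearMap.map_smul₂ (tmulₗ N P) a (h m) p }
    ⟨‖HomSpace.id P‖, fun h : HomSpace M N => (norm_tensorMap_le h _).trans_eq (mul_comm _ _)⟩

theorem dualTensorHom_tmul_apply {M N : BanMod R} (α : HomSpace M (unit R)) (n : N) (m : M) :
    (show HomSpace M N from dualTensorHom M N (tmul (M := dual M) α n)) m =
      (show R from α m) • n := by
  rw [dualTensorHom_tmul]
  rfl

/-- A bounded map `M → N` is trace class if it comes from an element of `M^∨ ⊗ N`. -/
def IsTraceClass {M N : BanMod R} (u : HomSpace M N) : Prop :=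
  ∃ t : tensorObj (dual M) N, dualTensorHom M N t = u

/-- The bounded map `Hom(W^∨, X) → X ⊗ V`, `h ↦ (h ⊗ id)(t)`, for `t ∈ W^∨ ⊗ V`. -/
def contract {W V : BanMod R} (t : tensorObj (dual W) V) (X : BanMod R) :
    HomSpace (homObj (dual W) X) (tensorObj X V) :=
  HomSpace.comp (eval _ (tensorObj X V) t) (rTensor (dual W) X V)

theorem contract_apply {W V X : BanMod R} (t : tensorObj (dual W) V) (h : HomSpace (dual W) X) :
    contract t X h = tensorMap h (HomSpace.id V) t :=
  eval_apply t (tensorMap h (HomSpace.id V))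

theorem tensorMap_tensorDualHom_tmul {W V X : BanMod R} (t : tensorObj (dual W) V) (x : X)
    (w : W) :
    tensorMap (show HomSpace (dual W) X from tensorDualHom X W (tmul x w)) (HomSpace.id V) t =
      tmul x ((show HomSpace W V from dualTensorHom W V t) w) := by
  let tmulLeft : HomSpace V (tensorObj X V) := HomSpace.mk (tmulₗ X V x) ⟨‖x‖, norm_tmul_le x⟩
  suffices h : tensorMap (show HomSpace (dual W) X from tensorDualHom X W (tmul x w))
      (HomSpace.id V) = HomSpace.comp tmulLeft (HomSpace.comp (eval W V w) (dualTensorHom W V)) from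
    (DFunLike.congr_fun h t).trans (congrArg (tmul x) (eval_apply w _))
  refine tensor_hom_ext fun (α : HomSpace W (unit R)) v => ?_
  have hl : tensorMap (show HomSpace (dual W) X from tensorDualHom X W (tmul x w))
      (HomSpace.id V) (tmul (M := dual W) α v) = tmul ((show R from α w) • x) v :=
    (tensorMap_tmul _ _ _ _).trans (congrArg (tmul · v) (tensorDualHom_tmul_apply x w α))
  have hr : eval W V w (dualTensorHom W V (tmul (M := dual W) α v)) = (show R from α w) • v :=
    (eval_apply w _).trans (dualTensorHom_tmul_apply α v w)
  have hc : tmul ((show R from α w) • x) v = tmul x ((show R from α w) • v) :=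
    (LinearMap.map_smul₂ (tmulₗ X V) _ x v).trans ((tmulₗ X V x).map_smul _ v).symm
  exact hl.trans (hc.trans (congrArg (tmul x) hr.symm))

theorem contract_comp_tensorDualHom {W V : BanMod R} (t : tensorObj (dual W) V) (X : BanMod R) :
    HomSpace.comp (contract t X) (tensorDualHom X W) =
      tensorMap (HomSpace.id X) (dualTensorHom W V t) := by
  refine tensor_hom_ext fun x w => ?_
  rw [HomSpace.comp_apply, contract_apply, tensorMap_tmul, HomSpace.id_apply]
  exact tensorMap_tensorDualHom_tmul t x w

theorem tensorDualHom_tensorMap_apply {W V X : BanMod R} (t : tensorObj (dual W) V)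
    (h : HomSpace (dual W) X) (β : HomSpace V (unit R)) :
    (show HomSpace (dual V) X from tensorDualHom X V (tensorMap h (HomSpace.id V) t)) β =
      h (HomSpace.comp β (dualTensorHom W V t)) := by
  suffices H : HomSpace.comp (eval (dual V) X β)
      (HomSpace.comp (tensorDualHom X V) (tensorMap h (HomSpace.id V))) =
        HomSpace.comp h (HomSpace.comp (homMap W β) (dualTensorHom W V)) from
    (eval_apply (M := dual V) β _).symm.trans (DFunLike.congr_fun H t)
  refine tensor_hom_ext fun (α : HomSpace W (unit R)) v => ?_
  have hl : (show HomSpace (dual V) X from tensorDualHom X V (tensorMap h (HomSpace.id V)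
      (tmul (M := dual W) α v))) β = (show R from β v) • h α :=
    tensorDualHom_tensorMap_tmul_apply (M := dual W) h _ α v β
  have hr : HomSpace.comp β (dualTensorHom W V (tmul (M := dual W) α v)) =
      (show R from β v) • α :=
    HomSpace.ext fun w => (congrArg β (dualTensorHom_tmul_apply α v w)).trans <|
      (β.map_smul _ v).trans (mul_comm (show R from α w) (show R from β v))
  exact (eval_apply (M := dual V) β _).trans <| hl.trans <| (h.map_smul _ _).symm.trans <|
    congrArg h hr.symm

theorem tensorDualHom_comp_contract {W V : BanMod R} (t : tensorObj (dual W) V) (X : BanMod R) :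
    HomSpace.comp (tensorDualHom X V) (contract t X) =
      precomp (precomp (dualTensorHom W V t) (unit R)) X := by
  refine HomSpace.ext fun (h : HomSpace (dual W) X) =>
    HomSpace.ext fun β : HomSpace V (unit R) => ?_
  calc (show HomSpace (dual V) X from tensorDualHom X V (contract t X h)) β =
        h (HomSpace.comp β (dualTensorHom W V t)) :=
        (congrArg (fun y => (show HomSpace (dual V) X from tensorDualHom X V y) β)
          (contract_apply t h)).trans (tensorDualHom_tensorMap_apply t h β)
    _ = (show HomSpace (dual V) X from
          precomp (precomp (dualTensorHom W V t) (unit R)) X h) β :=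
        (precomp_precomp_apply _ h β).symm

end BanMod

namespace IndBan

universe u

variable {R : Type u} [BanachRing R] {J : Type u} [SmallCategory J] [IsFiltered J]
  {D : J ⥤ BanMod R}

theorem IsNuclear.exists_isTraceClass {c : Cocone (D ⋙ Ind.yoneda)} (hV : IsNuclear c.pt)
    (hc : IsColimit c) (j : J) : ∃ (k : J) (f : j ⟶ k), BanMod.IsTraceClass (D.map f) := by
  let W := D.obj j
  let τ := BanMod.dualTensorHomNat W
  have hτ : IsIso ((IndExt.extendEndo.map τ).app c.pt) :=
    have h : IsIso ((IndExt.extendBiIso (BanMod.tensor R) (BanMod.dual W)).hom.app c.pt ≫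
        (IndExt.extendEndo.map τ).app c.pt) := hV W
    IsIso.of_isIso_comp_left
      ((IndExt.extendBiIso (BanMod.tensor R) (BanMod.dual W)).hom.app c.pt) _
  have : IsIso ((Ind.lim J).map (Functor.whiskerLeft D τ)) :=
    (NatIso.isIso_map_iff (IndExt.extendEndoObjIso hc) τ).1 hτ
  let x : BanMod.unit R ⟶ BanMod.homObj W W :=
    BanMod.rankOne (M := BanMod.unit R) (BanMod.HomSpace.id _) (BanMod.HomSpace.id W)
  obtain ⟨k, f, y, hy⟩ := IndExt.exists_lift_of_isIso_lim_map (Functor.whiskerLeft D τ) (j := j) x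
  let one : BanMod.unit R := (1 : R)
  exact ⟨k, f, (show BanMod.HomSpace (BanMod.unit R) _ from y) one, (DFunLike.congr_fun
    (F := BanMod.HomSpace (BanMod.unit R) (BanMod.homObj W (D.obj k))) hy one).trans
    (congrArg (BanMod.homMap W (D.map f)) (one_smul R (BanMod.HomSpace.id W)))⟩

theorem isIso_lim_map_tensorDualHomNat
    (h : ∀ j, ∃ (k : J) (f : j ⟶ k), BanMod.IsTraceClass (D.map f)) (X : BanMod R) :
    IsIso ((Ind.lim J).map (Functor.whiskerLeft D ((BanMod.tensorDualHomNat R).app X))) := by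
  refine IndExt.isIso_colimMap_of_interleaving _ fun j => ?_
  obtain ⟨k, f, t, ht⟩ := h j
  refine ⟨k, f, Ind.yoneda.map (BanMod.contract t X), ?_, ?_⟩
  · refine (Ind.yoneda.map_comp _ _).symm.trans (congrArg Ind.yoneda.map ?_)
    exact (BanMod.contract_comp_tensorDualHom t X).trans (congrArg (BanMod.tensorMap _) ht)
  · refine (Ind.yoneda.map_comp _ _).symm.trans (congrArg Ind.yoneda.map ?_)
    exact (BanMod.tensorDualHom_comp_contract t X).trans
      (congrArg (fun u => BanMod.precomp (BanMod.precomp u (BanMod.unit R)) X) ht)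

/-- For a filtered diagram `D` whose transition maps are eventually trace class,
`X ⊗ "colim" Dⱼ = "colim" Hom(Dⱼ^∨, X)`, naturally in the Banach module `X`. -/
def tensorIsoLimIhomDual {c : Cocone (D ⋙ Ind.yoneda)} (hc : IsColimit c)
    (h : ∀ j, ∃ (k : J) (f : j ⟶ k), BanMod.IsTraceClass (D.map f)) :
    Ind.yoneda ⋙ (tensor R).flip.obj c.pt ≅ (D ⋙ BanMod.ihomDual R).flip ⋙ Ind.lim J :=
  let τ : BanMod.tensor R ⋙ (Functor.whiskeringLeft J _ _).obj D ⋙ Ind.lim J ⟶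
      (D ⋙ BanMod.ihomDual R).flip ⋙ Ind.lim J :=
    Functor.whiskerRight (BanMod.tensorDualHomNat R)
      ((Functor.whiskeringLeft J _ _).obj D ⋙ Ind.lim J)
  have (X : BanMod R) : IsIso (τ.app X) := isIso_lim_map_tensorDualHomNat h X
  have := NatIso.isIso_of_isIso_app τ
  Functor.isoWhiskerRight (IndExt.extendIso (BanMod.tensor R ⋙ IndExt.extendEndo)).symm
      ((evaluation _ _).obj c.pt) ≪≫
    Functor.isoWhiskerLeft (BanMod.tensor R) (IndExt.extendEndoObjIso hc) ≪≫ asIso τ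

theorem IsNuclear.exists_tensor_iso {V : Ind (BanMod R)} (hV : IsNuclear V) :
    ∃ (J : Type u) (_ : SmallCategory J) (_ : IsFiltered J) (D : J ⥤ BanMod R),
      Nonempty (Ind.yoneda ⋙ (tensor R).flip.obj V ≅
        (D ⋙ BanMod.ihomDual R).flip ⋙ Ind.lim J) := by
  let c : Cocone (V.presentation.F ⋙ Ind.yoneda) :=
    (colimit.cocone _).extend V.colimitPresentationCompYoneda.hom
  have hc : IsColimit c := (colimit.isColimit _).extendIso _
  exact ⟨_, _, inferInstance, V.presentation.F,
    ⟨tensorIsoLimIhomDual hc (IsNuclear.exists_isTraceClass (c := c) hV hc)⟩⟩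

instance preservesColimit_tensor (V : Ind (BanMod R)) :
    PreservesColimit (D ⋙ Ind.yoneda) ((tensor R).flip.obj V) :=
  have := IndExt.preservesColimit_extend (BanMod.tensor R ⋙ IndExt.extendEndo) D
  inferInstanceAs (PreservesColimit _ (tensor R ⋙ (evaluation _ _).obj V))

theorem IsNuclear.preservesEqualizers_tensor {V : Ind (BanMod R)} (hV : IsNuclear V) :
    PreservesLimitsOfShape WalkingParallelPair ((tensor R).flip.obj V) := by
  obtain ⟨J, _, _, D, ⟨e⟩⟩ := hV.exists_tensor_iso
  have := preservesLimitsOfShape_of_natIso (J := WalkingParallelPair) e.symm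
  exact IndExt.preservesEqualizers_of_yoneda_comp ((tensor R).flip.obj V)
    (fun _ _ _ => inferInstance) (fun _ _ _ _ => inferInstance)

theorem IsNuclear.preservesZeroMorphisms_tensor {V : Ind (BanMod R)} (hV : IsNuclear V) :
    ((tensor R).flip.obj V).PreservesZeroMorphisms := by
  obtain ⟨J, _, _, D, ⟨e⟩⟩ := hV.exists_tensor_iso
  have := Functor.preservesZeroMorphisms_of_iso e.symm
  exact IndExt.preservesZeroMorphisms_of_yoneda_comp _

end IndBan

theorem mainTheorem5 {R : Type*} [BanachRing R] (V : Ind (BanMod R))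
    (hV : IndBan.IsNuclear V) : IndBan.IsFlat V := by
  have := hV.preservesEqualizers_tensor
  have := hV.preservesZeroMorphisms_tensor
  exact fun X Y f hf => hf.map ((IndBan.tensor R).flip.obj V)

end
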